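/- Let $\hbar\in\mathbb C$, $\hbar\neq 0$, and let $\kappa\in\mathbb C$ with $\operatorname{Re}\kappa<0$ and $\kappa\notin\mathbb R$. For functions $f,g$ of $(u,v)\in\mathbb C^2$, one of which is a polynomial, let $$f*_\kappa g=\sum_{k\ge 0}\frac{(i\hbar)^k}{k!\,2^k}\sum\Lambda^{i_1j_1}\cdots\Lambda^{i_kj_k}\,(\partial_{i_1}\cdots\partial_{i_k}f)(\partial_{j_1}\cdots\partial_{j_k}g),\qquad \Lambda=\begin{pmatrix}0&\kappa-1\\ \kappa+1&0\end{pmatrix},\ \partial_1=\partial_u,\ \partial_2=\partial_v .$$ For $z\in\mathbb C$ let $z+\frac{uv}{i\hbar}$ denote the element $z+\frac1{2i\hbar}(u*_\kappa v+v*_\kappa u)$ (as a function on $\mathbb C^2$ it is $z+\frac{\kappa}{2}+\frac{1}{i\hbar}uv$), and let $$e_*^{t(z+\frac{uv}{i\hbar})}=e^{tz}\,\frac{2}{\Delta(t)}\exp\Big(\frac{e^{t/2}-e^{-t/2}}{\Delta(t)}\,\frac{2uv}{i\hbar}\Big),\qquad \Delta(t)=(1-\kappa)e^{t/2}+(1+\kappa)e^{-t/2},$$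 be the $\kappa$-ordering expression of the star exponential, i.e. the solution of $\frac{d}{dt}f_t=(z+\frac{uv}{i\hbar})*_\kappa f_t$, $f_0=1$, continued to all complex $t$ with $\Delta(t)\ne0$. All limits below are uniform on compact subsets of $\mathbb C^2$. (1) For $\operatorname{Re}z>-\frac12$ the star gamma function $$\varGamma_*\big(z+\tfrac{uv}{i\hbar}\big)=\lim_{T,T'\to\infty}\int_{-T}^{T'}e^{-e^{\tau}}\,e_*^{\tau(z+\frac{uv}{i\hbar})}\,d\tau$$ exists, the integral over $\mathbb R$ being absolutely convergent at each point of $\mathbb C^2$. (2) Put $\sin_*\pi(z+\frac{uv}{i\hbar})=\frac1{2i}\big(e_*^{\pi i(z+\frac{uv}{i\hbar})}-e_*^{-\pi i(z+\frac{uv}{i\hbar})}\big)$. The star product $\sin_*\pi(z+\frac{uv}{i\hbar})*\varGamma_*(z+\frac{uv}{i\hbar})$, defined for $\operatorname{Re}z>-\frac12$ by $$\lim_{T,T'\to\infty}\int_{-T}^{T'}e^{-e^{\tau}}\,\frac{1}{2i}\Big(e_*^{(\tau+\pi i)(z+\frac{uv}{i\hbar})}-e_*^{(\tau-\pi i)(z+\frac{uv}{i\hbar})}\Big)d\tau$$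 (this limit exists, again with pointwise absolute convergence) and for the other $z$ by analytic continuation, is an entire function of $z$ with values in the entire functions on $\mathbb C^2$: there is exactly one function $F(z;u,v)$, holomorphic on $\mathbb C\times\mathbb C^2$, such that $F(z;\cdot)$ is that limit whenever $\operatorname{Re}z>-\frac12$. It satisfies $F(n+\frac12;\cdot)=0$ for every integer $n\ge0$. (By analogy with Euler's reflection formula, $F$ is also written $\frac{1}{\varGamma_*}(1-(z+\frac{uv}{i\hbar}))$.) -/

import Mathlib

namespace StarAlgebra

open Complex

/-- The partial derivative `∂_{u_i}` of a function on `ℂ²`; the coordinates are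
`x 0 = u` and `x 1 = v`. -/
noncomputable def partialD (i : Fin 2) (f : (Fin 2 → ℂ) → ℂ) : (Fin 2 → ℂ) → ℂ :=
  fun x => fderiv ℂ f x (Pi.single i 1)

/-- `∑ Λ^{i₁j₁} ⋯ Λ^{iₖjₖ} (∂_{i₁} ⋯ ∂_{iₖ} f) (∂_{j₁} ⋯ ∂_{jₖ} g)`. -/
noncomputable def biDiff (Λ : Matrix (Fin 2) (Fin 2) ℂ) :
    ℕ → ((Fin 2 → ℂ) → ℂ) → ((Fin 2 → ℂ) → ℂ) → (Fin 2 → ℂ) → ℂ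
  | 0, f, g => fun x => f x * g x
  | k + 1, f, g => fun x => ∑ i, ∑ j, Λ i j * biDiff Λ k (partialD i f) (partialD j g) x

/-- The matrix `Λ = K + J` of the `κ`-ordering, with `K = [[0, κ], [κ, 0]]` and
`J = [[0, -1], [1, 0]]`. -/
def orderingMatrix (κ : ℂ) : Matrix (Fin 2) (Fin 2) ℂ :=
  !![0, κ; κ, 0] + !![0, -1; 1, 0]

/-- The product `f *_κ g` (a finite sum as soon as `f` or `g` is a polynomial). -/
noncomputable def starProd (ħ κ : ℂ) (f g : (Fin 2 → ℂ) → ℂ) : (Fin 2 → ℂ) → ℂ :=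
  fun x => ∑' k : ℕ, (I * ħ) ^ k / ((k.factorial : ℂ) * 2 ^ k) *
    biDiff (orderingMatrix κ) k f g x

/-- The coordinate function `u`. -/
def coordU : (Fin 2 → ℂ) → ℂ := fun x => x 0

/-- The coordinate function `v`. -/
def coordV : (Fin 2 → ℂ) → ℂ := fun x => x 1

/-- The `κ`-ordering expression of the element `z + uv/(iħ)` of the Weyl algebra, where
`uv` stands for the symmetrized element `(u * v + v * u) / 2`. -/
noncomputable def generator (ħ κ z : ℂ) : (Fin 2 → ℂ) → ℂ :=
  fun x => z + 1 / (I * ħ) *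
    (1 / 2 * (starProd ħ κ coordU coordV x + starProd ħ κ coordV coordU x))

/-- The function `(1 - κ) e^{t/2} + (1 + κ) e^{-t/2}`, whose zeros are the singular points of
the star exponential. -/
noncomputable def starExpDenom (κ t : ℂ) : ℂ :=
  (1 - κ) * exp (t / 2) + (1 + κ) * exp (-(t / 2))

/-- The `κ`-ordering expression of the star exponential `e_*^{t (z + uv/(iħ))}`: the solution of
`d/dt f_t = (z + uv/(iħ)) *_κ f_t`, `f_0 = 1`, continued to all complex `t` off the singular
points (see `starExp_zero` and `hasDerivAt_starExp`). -/
noncomputable def starExp (ħ κ z t : ℂ) : (Fin 2 → ℂ) → ℂ :=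
  fun x => exp (t * z) * (2 / starExpDenom κ t *
    exp ((exp (t / 2) - exp (-(t / 2))) / starExpDenom κ t * (2 / (I * ħ) * (x 0 * x 1))))

/-- The `κ`-ordering expression of `sin_* π(z + uv/(iħ))`, that is of
`(e_*^{πi(z + uv/(iħ))} - e_*^{-πi(z + uv/(iħ))}) / 2i`. -/
noncomputable def starSin (ħ κ z : ℂ) : (Fin 2 → ℂ) → ℂ :=
  fun x => (starExp ħ κ z (Real.pi * I) x - starExp ħ κ z (-(Real.pi * I)) x) / (2 * I)

/-- The `κ`-ordering expression of `sin_* π(z + uv/(iħ)) * e_*^{τ (z + uv/(iħ))}`, as given by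
the exponential law; as a function of `τ` it is the solution of
`d/dτ f_τ = (z + uv/(iħ)) *_κ f_τ` with `f_0 = sin_* π(z + uv/(iħ))`
(see `starSinMulExp_zero` and `hasDerivAt_starSinMulExp`). -/
noncomputable def starSinMulExp (ħ κ z : ℂ) (τ : ℝ) : (Fin 2 → ℂ) → ℂ :=
  fun x => (starExp ħ κ z (τ + Real.pi * I) x - starExp ħ κ z (τ - Real.pi * I) x) / (2 * I)

/-- `f = lim_{T, T' → ∞} ∫_{-T}^{T'} e^{-e^τ} G_τ dτ`, the limit being uniform on compact subsets
of `ℂ²` and the integral over `ℝ` being absolutely convergent at each point. -/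
def HasGammaIntegral (G : ℝ → (Fin 2 → ℂ) → ℂ) (f : (Fin 2 → ℂ) → ℂ) : Prop :=
  (∀ x, MeasureTheory.Integrable fun τ : ℝ => exp (-exp (τ : ℂ)) * G τ x) ∧
  TendstoLocallyUniformly
    (fun (T : ℝ × ℝ) x => ∫ τ in (-T.1)..T.2, exp (-exp (τ : ℂ)) * G τ x)
    f (Filter.atTop ×ˢ Filter.atTop)

/-- `g` is the `κ`-ordering expression of
`Γ_*(z + uv/(iħ)) = ∫ e^{-e^τ} e_*^{τ (z + uv/(iħ))} dτ`. -/
def IsStarGamma (ħ κ z : ℂ) (g : (Fin 2 → ℂ) → ℂ) : Prop :=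
  HasGammaIntegral (fun τ : ℝ => starExp ħ κ z τ) g

/-- `F` is the `κ`-ordering expression of `sin_* π(z + uv/(iħ)) * Γ_*(z + uv/(iħ))`, as an entire
function of `z` (with values in the entire functions of `(u, v)`): for `Re z > -1/2` the product
is the integral `∫ e^{-e^τ} sin_* π(z + uv/(iħ)) * e_*^{τ (z + uv/(iħ))} dτ`, and it is extended
to all `z` by analytic continuation. -/
def IsStarSinMulGamma (ħ κ : ℂ) (F : ℂ → (Fin 2 → ℂ) → ℂ) : Prop :=
  Differentiable ℂ (fun p : ℂ × (Fin 2 → ℂ) => F p.1 p.2) ∧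
  ∀ z : ℂ, -(1 / 2) < z.re → HasGammaIntegral (starSinMulExp ħ κ z) (F z)

/-! ### The star exponential solves its evolution equation -/

theorem starExp_zero (ħ κ z : ℂ) : starExp ħ κ z 0 = fun _ => 1 := by
  funext x
  have h : starExpDenom κ 0 = 2 := by simp [starExpDenom]; ring
  simp [starExp, h]

theorem starSinMulExp_zero (ħ κ z : ℂ) : starSinMulExp ħ κ z 0 = starSin ħ κ z := by
  funext x
  simp [starSinMulExp, starSin]

theorem partialD_const (i : Fin 2) (c : ℂ) : partialD i (fun _ => c) = fun _ => 0 := by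
  funext x
  simp [partialD]

theorem partialD_of_hasFDerivAt {f : (Fin 2 → ℂ) → ℂ} {x : Fin 2 → ℂ}
    {f' : (Fin 2 → ℂ) →L[ℂ] ℂ} (h : HasFDerivAt f f' x) (i : Fin 2) :
    partialD i f x = f' (Pi.single i 1) := by
  rw [partialD, h.fderiv]

theorem biDiff_zero_left (Λ : Matrix (Fin 2) (Fin 2) ℂ) (k : ℕ) (g : (Fin 2 → ℂ) → ℂ) :
    biDiff Λ k (fun _ => 0) g = fun _ => 0 := by
  induction k generalizing g with
  | zero => funext x; simp [biDiff]
  | succ k ih =>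
    funext x
    simp [biDiff, partialD_const, ih]

theorem partialD_linear (b : ℂ) (i j : Fin 2) :
    partialD i (fun y : Fin 2 → ℂ => b * y j) = fun _ => if i = j then b else 0 := by
  funext x
  have h : HasFDerivAt (fun y : Fin 2 → ℂ => b * y j)
      (b • (ContinuousLinearMap.proj j : (Fin 2 → ℂ) →L[ℂ] ℂ)) x :=
    (hasFDerivAt_apply j x).const_mul b
  rw [partialD_of_hasFDerivAt h]
  fin_cases i <;> fin_cases j <;> simp

theorem hasFDerivAt_mul (x : Fin 2 → ℂ) :
    HasFDerivAt (fun y : Fin 2 → ℂ => y 0 * y 1)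
      (x 0 • (ContinuousLinearMap.proj 1 : (Fin 2 → ℂ) →L[ℂ] ℂ) +
        x 1 • (ContinuousLinearMap.proj 0 : (Fin 2 → ℂ) →L[ℂ] ℂ)) x :=
  (hasFDerivAt_apply 0 x).mul (hasFDerivAt_apply 1 x)

theorem partialD_zero_quadratic (a b : ℂ) :
    partialD 0 (fun y : Fin 2 → ℂ => a + b * (y 0 * y 1)) = fun y => b * y 1 := by
  funext x
  rw [partialD_of_hasFDerivAt (((hasFDerivAt_mul x).const_mul b).const_add a)]
  simp

theorem partialD_one_quadratic (a b : ℂ) :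
    partialD 1 (fun y : Fin 2 → ℂ => a + b * (y 0 * y 1)) = fun y => b * y 0 := by
  funext x
  rw [partialD_of_hasFDerivAt (((hasFDerivAt_mul x).const_mul b).const_add a)]
  simp

/-- The product with a quadratic left factor `a + b uv`. -/
theorem starProd_quadratic (ħ κ a b : ℂ) (g : (Fin 2 → ℂ) → ℂ) (x : Fin 2 → ℂ) :
    starProd ħ κ (fun y => a + b * (y 0 * y 1)) g x =
      (a + b * (x 0 * x 1)) * g x
      + I * ħ / 2 * b * ((κ - 1) * x 1 * partialD 1 g x + (κ + 1) * x 0 * partialD 0 g x)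
      + (I * ħ) ^ 2 / 8 * b * ((κ - 1) * (κ + 1)) *
        (partialD 0 (partialD 1 g) x + partialD 1 (partialD 0 g) x) := by
  rw [starProd, tsum_eq_sum (s := Finset.range 3)]
  · simp [Finset.sum_range_succ, biDiff, orderingMatrix, partialD_zero_quadratic,
      partialD_one_quadratic, partialD_linear, Fin.sum_univ_two]
    ring
  · intro k hk
    obtain ⟨m, rfl⟩ : ∃ m, k = m + 3 := ⟨k - 3, by simp at hk; omega⟩
    have h0 (i : Fin 2) : partialD i (fun _ => (0 : ℂ)) = fun _ => 0 := partialD_const i 0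
    simp [biDiff, partialD_zero_quadratic, partialD_one_quadratic, partialD_linear,
      Fin.sum_univ_two, partialD_const, biDiff_zero_left]

theorem starProd_coord (ħ κ : ℂ) (i j : Fin 2) (x : Fin 2 → ℂ) :
    starProd ħ κ (fun y => y i) (fun y => y j) x =
      x i * x j + I * ħ / 2 * orderingMatrix κ i j := by
  have h1 (i j : Fin 2) : partialD i (fun y : Fin 2 → ℂ => y j) =
      fun _ => if i = j then 1 else 0 := by
    simpa using partialD_linear 1 i j
  rw [starProd, tsum_eq_sum (s := Finset.range 2)]
  · fin_cases i <;> fin_cases j <;>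
      simp [Finset.sum_range_succ, biDiff, h1]
  · intro k hk
    obtain ⟨m, rfl⟩ : ∃ m, k = m + 2 := ⟨k - 2, by simp at hk; omega⟩
    simp [biDiff, h1, partialD_const, biDiff_zero_left]

/-- The `κ`-ordering expression of `z + uv/(iħ)` is `z + κ/2 + uv/(iħ)`. -/
theorem generator_eq {ħ : ℂ} (hħ : ħ ≠ 0) (κ z : ℂ) :
    generator ħ κ z = fun x => (z + κ / 2) + 1 / (I * ħ) * (x 0 * x 1) := by
  funext x
  have e1 := starProd_coord ħ κ 0 1 x
  have e2 := starProd_coord ħ κ 1 0 x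
  change z + 1 / (I * ħ) * (1 / 2 * (starProd ħ κ (fun y => y 0) (fun y => y 1) x +
    starProd ħ κ (fun y => y 1) (fun y => y 0) x)) = _
  rw [e1, e2]
  have hI : I * ħ ≠ 0 := mul_ne_zero I_ne_zero hħ
  simp only [orderingMatrix, Matrix.add_apply, Matrix.of_apply, Matrix.cons_val_zero,
    Matrix.cons_val_one, Matrix.cons_val', Matrix.cons_val_fin_one]
  generalize I * ħ = q at *
  field_simp
  ring

theorem partialD_mul_exp (i : Fin 2) (c d : ℂ) (p : (Fin 2 → ℂ) → ℂ) (x : Fin 2 → ℂ)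
    (hp : DifferentiableAt ℂ p x) :
    partialD i (fun y => p y * (c * exp (d * (y 0 * y 1)))) x =
      (partialD i p x + p x * (d * if i = 0 then x 1 else x 0)) *
        (c * exp (d * (x 0 * x 1))) := by
  have h : HasFDerivAt (fun y => p y * (c * exp (d * (y 0 * y 1)))) _ x :=
    hp.hasFDerivAt.mul ((((hasFDerivAt_mul x).const_mul d).cexp).const_mul c)
  rw [partialD_of_hasFDerivAt h, partialD]
  fin_cases i <;> simp <;> ring

/-- The evolution equation of the star exponential at every nonsingular point. -/
theorem hasDerivAt_starExp {ħ : ℂ} (hħ : ħ ≠ 0) (κ z t : ℂ) (ht : starExpDenom κ t ≠ 0)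
    (x : Fin 2 → ℂ) :
    HasDerivAt (fun s => starExp ħ κ z s x)
      (starProd ħ κ (generator ħ κ z) (starExp ħ κ z t) x) t := by
  set c : ℂ := exp (t * z) * (2 / starExpDenom κ t) with hc
  set d : ℂ := (exp (t / 2) - exp (-(t / 2))) / starExpDenom κ t * (2 / (I * ħ)) with hd
  have hE : starExp ħ κ z t = fun y => c * exp (d * (y 0 * y 1)) := by
    funext y
    simp only [starExp, hc, hd]
    ring_nf
  have p0 : partialD 0 (starExp ħ κ z t) =
      fun y => (d * y 1) * (c * exp (d * (y 0 * y 1))) := by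
    funext y
    have := partialD_mul_exp 0 c d (fun _ => 1) y (by fun_prop)
    simpa [hE, partialD_const] using this
  have p1 : partialD 1 (starExp ħ κ z t) =
      fun y => (d * y 0) * (c * exp (d * (y 0 * y 1))) := by
    funext y
    have := partialD_mul_exp 1 c d (fun _ => 1) y (by fun_prop)
    simpa [hE, partialD_const] using this
  have p10 : partialD 1 (partialD 0 (starExp ħ κ z t)) x =
      (d + d * x 1 * (d * x 0)) * (c * exp (d * (x 0 * x 1))) := by
    rw [p0, partialD_mul_exp 1 c d _ x (by fun_prop), partialD_linear]
    simp
  have p01 : partialD 0 (partialD 1 (starExp ħ κ z t)) x =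
      (d + d * x 0 * (d * x 1)) * (c * exp (d * (x 0 * x 1))) := by
    rw [p1, partialD_mul_exp 0 c d _ x (by fun_prop), partialD_linear]
    simp
  rw [generator_eq hħ, starProd_quadratic, p10, p01, p0, p1, hE]
  have hA : HasDerivAt (fun s : ℂ => exp (s / 2)) (exp (t / 2) * (1 / 2)) t :=
    ((hasDerivAt_id t).div_const 2).cexp
  have hB : HasDerivAt (fun s : ℂ => exp (-(s / 2))) (exp (-(t / 2)) * (-(1 / 2))) t :=
    ((hasDerivAt_id t).div_const 2).neg.cexp
  have hZ : HasDerivAt (fun s : ℂ => exp (s * z)) (exp (t * z) * (1 * z)) t :=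
    ((hasDerivAt_id t).mul_const z).cexp
  have hD : HasDerivAt (fun s : ℂ => starExpDenom κ s)
      ((1 - κ) * (exp (t / 2) * (1 / 2)) + (1 + κ) * (exp (-(t / 2)) * (-(1 / 2)))) t :=
    (hA.const_mul _).add (hB.const_mul _)
  have hX : HasDerivAt (fun s : ℂ => exp ((exp (s / 2) - exp (-(s / 2))) / starExpDenom κ s *
      (2 / (I * ħ) * (x 0 * x 1)))) _ t :=
    (((hA.sub hB).div hD ht).mul_const (2 / (I * ħ) * (x 0 * x 1))).cexp
  have hF : HasDerivAt (fun s => starExp ħ κ z s x) _ t :=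
    hZ.mul (((hasDerivAt_const t (2 : ℂ)).div hD ht).mul hX)
  refine hF.congr_deriv ?_
  have hx : d * (x 0 * x 1) =
      (exp (t / 2) - exp (-(t / 2))) / starExpDenom κ t * (2 / (I * ħ) * (x 0 * x 1)) := by
    rw [hd]; ring
  have hq : I * ħ ≠ 0 := mul_ne_zero I_ne_zero hħ
  simp only [Pi.sub_apply, Pi.div_apply, hx]
  clear hF hX hD hZ hA hB hx hE p0 p1 p10 p01
  rw [hc, hd]
  generalize exp ((exp (t / 2) - exp (-(t / 2))) / starExpDenom κ t *
    (2 / (I * ħ) * (x 0 * x 1))) = W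
  have hDe : starExpDenom κ t = (1 - κ) * exp (t / 2) + (1 + κ) * exp (-(t / 2)) := rfl
  clear hc hd c d
  generalize starExpDenom κ t = D at *
  generalize exp (t / 2) = A at *
  generalize exp (-(t / 2)) = B at *
  generalize exp (t * z) = Z at *
  generalize I * ħ = q at *
  field_simp
  rw [hDe]
  ring

theorem starProd_quadratic_const_mul (ħ κ a b C : ℂ) (g : (Fin 2 → ℂ) → ℂ) (x : Fin 2 → ℂ) :
    starProd ħ κ (fun y => a + b * (y 0 * y 1)) (fun y => C * g y) x =
      C * starProd ħ κ (fun y => a + b * (y 0 * y 1)) g x := by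
  have h (i : Fin 2) (f : (Fin 2 → ℂ) → ℂ) :
      partialD i (fun y => C * f y) = fun y => C * partialD i f y := by
    funext y
    have : fderiv ℂ (fun y => C * f y) y = C • fderiv ℂ f y := by
      have := congrFun (fderiv_const_smul_field (𝕜 := ℂ) (f := f) C) y
      exact this
    simp [partialD, this]
  simp only [starProd_quadratic, h]
  ring

theorem starExp_sub_two_pi (ħ κ z t : ℂ) :
    starExp ħ κ z (t - Real.pi * I) =
      fun x => -exp (-(2 * Real.pi * I * z)) * starExp ħ κ z (t + Real.pi * I) x := by
  have hA : exp ((t - Real.pi * I) / 2) = -exp ((t + Real.pi * I) / 2) := by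
    rw [show (t - Real.pi * I) / 2 = (t + Real.pi * I) / 2 - Real.pi * I by ring,
      exp_sub_pi_mul_I]
  have hB : exp (-((t - Real.pi * I) / 2)) = -exp (-((t + Real.pi * I) / 2)) := by
    rw [show -((t - Real.pi * I) / 2) = -((t + Real.pi * I) / 2) + Real.pi * I by ring,
      exp_add_pi_mul_I]
  have hD : starExpDenom κ (t - Real.pi * I) = -starExpDenom κ (t + Real.pi * I) := by
    simp only [starExpDenom, hA, hB]; ring
  have hZ : exp ((t - Real.pi * I) * z) =
      exp (-(2 * Real.pi * I * z)) * exp ((t + Real.pi * I) * z) := by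
    rw [← exp_add]; congr 1; ring
  funext x
  simp only [starExp, hA, hB, hD, hZ]
  rw [show -exp ((t + Real.pi * I) / 2) - -exp (-((t + Real.pi * I) / 2)) =
    -(exp ((t + Real.pi * I) / 2) - exp (-((t + Real.pi * I) / 2))) by ring, neg_div_neg_eq,
    div_neg]
  ring

/-- The evolution equation of `sin_* π(z + uv/(iħ)) * e_*^{τ (z + uv/(iħ))}`. -/
theorem hasDerivAt_starSinMulExp {ħ : ℂ} (hħ : ħ ≠ 0) (κ z : ℂ) (τ : ℝ)
    (hτ : starExpDenom κ (τ + Real.pi * I) ≠ 0) (x : Fin 2 → ℂ) :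
    HasDerivAt (fun s : ℝ => starSinMulExp ħ κ z s x)
      (starProd ħ κ (generator ħ κ z) (starSinMulExp ħ κ z τ) x) τ := by
  set C : ℂ := (1 + exp (-(2 * Real.pi * I * z))) / (2 * I) with hC
  have hE (s : ℝ) : starSinMulExp ħ κ z s =
      fun y => C * starExp ħ κ z (s + Real.pi * I) y := by
    funext y
    simp only [starSinMulExp, starExp_sub_two_pi, hC]
    ring
  have h := (hasDerivAt_starExp hħ κ z _ hτ x).comp_add_const (τ : ℂ) (Real.pi * I)
  have h' := (h.const_mul C).comp_ofReal
  rw [hE τ, generator_eq hħ, starProd_quadratic_const_mul, ← generator_eq hħ]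
  simpa only [hE] using h'

theorem exp_half_mul_self (t : ℂ) : exp (t / 2) * exp (t / 2) = exp t := by
  rw [← exp_add]; congr 1; ring

/-- In the `κ`-ordering with `κ` nonreal, no singular point of the star exponential lies on the
real line or on the lines `Im t = ± π`. -/
theorem starExpDenom_ne_zero {κ : ℂ} (hκ : κ.im ≠ 0) (τ : ℝ) :
    starExpDenom κ τ ≠ 0 ∧ starExpDenom κ (τ + Real.pi * I) ≠ 0 ∧
      starExpDenom κ (τ - Real.pi * I) ≠ 0 := by
  have key (t : ℂ) (r : ℝ) (ht : exp t = r) : starExpDenom κ t ≠ 0 := by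
    intro h
    have hAB : exp (t / 2) * exp (-(t / 2)) = 1 := by rw [← exp_add]; simp
    have h2 : (1 - κ) * (r : ℂ) + (1 + κ) = 0 := by
      rw [starExpDenom] at h
      rw [← ht, ← exp_half_mul_self]
      linear_combination exp (t / 2) * h - (1 + κ) * hAB
    have him := congrArg Complex.im h2
    have hre := congrArg Complex.re h2
    simp at him hre
    have hr : r = 1 := by
      have : κ.im * (1 - r) = 0 := by linarith
      rcases mul_eq_zero.mp this with h | h
      · exact absurd h hκ
      · linarith
    rw [hr] at hre
    linarith
  refine ⟨key τ (Real.exp τ) (by simp), key _ (-Real.exp τ) ?_, key _ (-Real.exp τ) ?_⟩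
  · rw [exp_add_pi_mul_I]; simp
  · rw [exp_sub_pi_mul_I]; simp

end StarAlgebra

/-!
Write `s = e^τ` and `W = 2uv/(iħ)`. On the real line the star exponential is
`2 s^{z + 1/2} r(s) exp (W (s - 1) r(s))` with `r(s) = 1 / ((1 - κ) s + (1 + κ))`, and on the lines
`Im t = ± π` it has the same shape with `s + 1` for `s - 1`, `r(s) = 1 / ((1 - κ) s - (1 + κ))` and
a constant factor. Since `κ` is not real, `r` is bounded for `s > 0`. The exponent is an affine
function of `r`, so both integrals are, up to factors constant in `s`, Mellin transforms
`∫ s^{a-1} e^{-s} r^k e^{wr} ds` with `a = z + 1/2`, `k = 1` and `w` a multiple of `W`. They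
converge absolutely, locally uniformly in `w`, for `Re a > 0`
(`hasGammaIntegral_of_eq_gammaKernel`), and differentiation under the integral sign shows that they
are holomorphic in `(a, w)` (`differentiableAt_integral_gammaKernel`).

Because `r' = -(1 - κ) r²`, the family of these transforms, `k = 0, 1, 2, …`, is closed under
partial integration (`mul_integral_gammaKernel`). After division by `Γ(a)` the resulting recurrence
expresses the transform at `a` through transforms at `a + 1` with no denominators, so that it
continues to an entire function `J(a, w)` (`exists_differentiable_integral_gammaKernel`).

The two lines `Im t = ± π` contribute together the factor `-2 sin πa`
(`exp_neg_exp_mul_starSinMulExp`), and `sin πa · Γ(a) = π / Γ(1 - a)` is entire. Hence the product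
of `sin_*` and `Γ_*` is `-2π / Γ(1/2 - z)` times an exponential times `J`, which is entire and
vanishes at `z = n + 1/2`. Uniqueness is the identity theorem (`IsStarSinMulGamma.unique`).
-/

namespace StarAlgebra

open Complex MeasureTheory Filter Topology

/-! ### Mellin kernels in the logarithmic variable -/

theorem integrable_exp_mul_exp_neg_exp {b : ℝ} (hb : 0 < b) :
    Integrable fun τ : ℝ => Real.exp (b * τ) * Real.exp (-Real.exp τ) := by
  have h := Real.GammaIntegral_convergent hb
  rw [← Real.range_exp, ← Set.image_univ, integrableOn_image_iff_integrableOn_abs_deriv_smul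
    MeasurableSet.univ (fun x _ => (Real.hasDerivAt_exp x).hasDerivWithinAt)
    Real.exp_injective.injOn, integrableOn_univ] at h
  refine h.congr (Eventually.of_forall fun τ => ?_)
  simp only [smul_eq_mul, abs_of_pos (Real.exp_pos τ), ← Real.exp_mul]
  rw [mul_left_comm, ← Real.exp_add, mul_comm]
  ring_nf

theorem norm_exp_neg_exp_ofReal (τ : ℝ) :
    ‖exp (-exp (τ : ℂ))‖ = Real.exp (-Real.exp τ) := by
  rw [norm_exp, ← ofReal_exp, neg_re, ofReal_re]

/-- The integrand of `∫ s^{a-1} e^{-s} q^k e^{wq} ds` over `(0, ∞)` after the substitution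
`s = e^τ`; the function `q` is given in the variable `τ`. -/
noncomputable def gammaKernel (q : ℝ → ℂ) (k : ℕ) (a w : ℂ) (τ : ℝ) : ℂ :=
  exp (-exp (τ : ℂ)) * (exp (a * τ) * (q τ ^ k * exp (w * q τ)))

theorem norm_gammaKernel_le {q : ℝ → ℂ} {M : ℝ} (hM : ∀ τ, ‖q τ‖ ≤ M) (k : ℕ) (a : ℂ) {w : ℂ}
    {R : ℝ} (hw : ‖w‖ ≤ R) (τ : ℝ) :
    ‖gammaKernel q k a w τ‖ ≤
      M ^ k * Real.exp (R * M) * (Real.exp (a.re * τ) * Real.exp (-Real.exp τ)) := by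
  have h0 : 0 ≤ M := (norm_nonneg _).trans (hM τ)
  have h1 : ‖exp (w * q τ)‖ ≤ Real.exp (R * M) := by
    refine (norm_exp_le_exp_norm _).trans (Real.exp_le_exp.2 ?_)
    rw [norm_mul]
    exact mul_le_mul hw (hM τ) (norm_nonneg _) ((norm_nonneg _).trans hw)
  have h2 : ‖exp (a * τ)‖ = Real.exp (a.re * τ) := by rw [norm_exp]; simp
  rw [gammaKernel, norm_mul, norm_mul, norm_mul, norm_pow, norm_exp_neg_exp_ofReal, h2]
  have h3 : ‖q τ‖ ^ k * ‖exp (w * q τ)‖ ≤ M ^ k * Real.exp (R * M) :=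
    mul_le_mul (pow_le_pow_left₀ (norm_nonneg _) (hM τ) k) h1 (norm_nonneg _) (pow_nonneg h0 k)
  calc _ = ‖q τ‖ ^ k * ‖exp (w * q τ)‖ * (Real.exp (a.re * τ) * Real.exp (-Real.exp τ)) := by ring
    _ ≤ _ := mul_le_mul_of_nonneg_right h3 (by positivity)

theorem continuous_gammaKernel {q : ℝ → ℂ} (hq : Continuous q) (k : ℕ) (a w : ℂ) :
    Continuous (gammaKernel q k a w) := by
  unfold gammaKernel
  fun_prop

theorem integrable_gammaKernel {q : ℝ → ℂ} (hq : Continuous q) {M : ℝ} (hM : ∀ τ, ‖q τ‖ ≤ M)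
    (k : ℕ) {a : ℂ} (ha : 0 < a.re) (w : ℂ) : Integrable (gammaKernel q k a w) :=
  ((integrable_exp_mul_exp_neg_exp ha).const_mul _).mono'
    (continuous_gammaKernel hq k a w).aestronglyMeasurable
    (Eventually.of_forall (norm_gammaKernel_le hM k a le_rfl))

/-- The factor `τ`, which differentiation in the exponent brings down, costs only a small change
of the exponent. -/
theorem abs_add_mul_exp_le {δ x M : ℝ} (hδ : 0 < δ) (hM : 0 ≤ M) (h1 : 2 * δ ≤ x)
    (h2 : x ≤ 6 * δ) (τ : ℝ) :
    (|τ| + M) * Real.exp (x * τ) ≤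
      (δ⁻¹ + M) * (Real.exp (δ * τ) + Real.exp (7 * δ * τ)) := by
  have hA : |τ| + M ≤ (δ⁻¹ + M) * Real.exp (δ * |τ|) := by
    have e1 := Real.add_one_le_exp (δ * |τ|)
    have e2 : |τ| ≤ δ⁻¹ * Real.exp (δ * |τ|) := by
      rw [inv_mul_eq_div, le_div_iff₀ hδ]; linarith
    have e3 : (1 : ℝ) ≤ Real.exp (δ * |τ|) := Real.one_le_exp (by positivity)
    nlinarith
  have hB : Real.exp (δ * |τ|) * Real.exp (x * τ) ≤
      Real.exp (δ * τ) + Real.exp (7 * δ * τ) := by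
    rw [← Real.exp_add]
    rcases le_total 0 τ with h | h
    · rw [abs_of_nonneg h]
      have : Real.exp (δ * τ + x * τ) ≤ Real.exp (7 * δ * τ) := Real.exp_le_exp.2 (by nlinarith)
      linarith [Real.exp_pos (δ * τ)]
    · rw [abs_of_nonpos h]
      have : Real.exp (δ * -τ + x * τ) ≤ Real.exp (δ * τ) := Real.exp_le_exp.2 (by nlinarith)
      linarith [Real.exp_pos (7 * δ * τ)]
  calc _ ≤ (δ⁻¹ + M) * Real.exp (δ * |τ|) * Real.exp (x * τ) :=
        mul_le_mul_of_nonneg_right hA (Real.exp_pos _).le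
    _ = (δ⁻¹ + M) * (Real.exp (δ * |τ|) * Real.exp (x * τ)) := by ring
    _ ≤ _ := mul_le_mul_of_nonneg_left hB (by positivity)

theorem differentiableAt_integral_gammaKernel {q : ℝ → ℂ} (hq : Continuous q) {M : ℝ}
    (hM : ∀ τ, ‖q τ‖ ≤ M) (k : ℕ) {p : ℂ × ℂ} (hp : 0 < p.1.re) :
    DifferentiableAt ℂ (fun p : ℂ × ℂ => ∫ τ, gammaKernel q k p.1 p.2 τ) p := by
  -- on the ball of radius `2δ` the real part of the exponent stays between `2δ` and `6δ`
  obtain ⟨δ, hδ, hpδ⟩ : ∃ δ : ℝ, 0 < δ ∧ p.1.re = 4 * δ := ⟨p.1.re / 4, by linarith, by ring⟩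
  have h0 : 0 ≤ M := (norm_nonneg _).trans (hM 0)
  -- the derivative of the integrand in `(a, w)`
  set D : ℂ × ℂ → ℝ → ℂ × ℂ →L[ℂ] ℂ := fun p τ =>
    gammaKernel q k p.1 p.2 τ •
      ((τ : ℂ) • ContinuousLinearMap.fst ℂ ℂ ℂ + q τ • ContinuousLinearMap.snd ℂ ℂ ℂ) with hD
  set C : ℝ := M ^ k * Real.exp ((‖p.2‖ + 2 * δ) * M) with hC
  refine (hasFDerivAt_integral_of_dominated_of_fderiv_le (F' := D)
    (bound := fun τ => C * ((δ⁻¹ + M) * (Real.exp (δ * τ) * Real.exp (-Real.exp τ) +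
      Real.exp (7 * δ * τ) * Real.exp (-Real.exp τ))))
    (Metric.ball_mem_nhds p (show (0 : ℝ) < 2 * δ by positivity))
    (Eventually.of_forall fun p => (continuous_gammaKernel hq k p.1 p.2).aestronglyMeasurable)
    (integrable_gammaKernel hq hM k hp p.2) ?_ ?_ ?_ ?_).differentiableAt
  · refine Continuous.aestronglyMeasurable ?_
    exact (continuous_gammaKernel hq k p.1 p.2).smul
      ((continuous_ofReal.smul continuous_const).add (hq.smul continuous_const))
  · refine Eventually.of_forall fun τ y hy => ?_
    rw [Metric.mem_ball, dist_eq_norm] at hy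
    have y1 : ‖y.1 - p.1‖ ≤ 2 * δ := (norm_fst_le (y - p)).trans hy.le
    have y2 : ‖y.2‖ ≤ ‖p.2‖ + 2 * δ := by
      have := (norm_snd_le (y - p)).trans hy.le
      have h := norm_add_le p.2 (y.2 - p.2)
      rw [add_sub_cancel] at h
      simp only [Prod.snd_sub] at this
      linarith
    have y3 := abs_le.1 ((abs_re_le_norm _).trans y1)
    rw [sub_re] at y3
    have hL : ‖(τ : ℂ) • ContinuousLinearMap.fst ℂ ℂ ℂ + q τ • ContinuousLinearMap.snd ℂ ℂ ℂ‖ ≤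
        |τ| + M := by
      refine (norm_add_le _ _).trans (add_le_add ?_ ?_)
      · rw [norm_smul, norm_real, Real.norm_eq_abs]
        exact mul_le_of_le_one_right (abs_nonneg _) (ContinuousLinearMap.norm_fst_le ℂ ℂ ℂ)
      · rw [norm_smul]
        exact (mul_le_of_le_one_right (norm_nonneg _)
          (ContinuousLinearMap.norm_snd_le ℂ ℂ ℂ)).trans (hM τ)
    have hE := abs_add_mul_exp_le hδ h0 (show 2 * δ ≤ y.1.re by linarith)
      (show y.1.re ≤ 6 * δ by linarith) τ
    rw [hD, norm_smul]
    calc _ ≤ C * (Real.exp (y.1.re * τ) * Real.exp (-Real.exp τ)) * (|τ| + M) :=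
          mul_le_mul (norm_gammaKernel_le hM k y.1 y2 τ) hL (norm_nonneg _) (by positivity)
      _ = C * Real.exp (-Real.exp τ) * ((|τ| + M) * Real.exp (y.1.re * τ)) := by ring
      _ ≤ C * Real.exp (-Real.exp τ) * _ := mul_le_mul_of_nonneg_left hE (by positivity)
      _ = _ := by ring
  · exact (((integrable_exp_mul_exp_neg_exp hδ).add
      (integrable_exp_mul_exp_neg_exp (by positivity))).const_mul _).const_mul _
  · refine Eventually.of_forall fun τ y _ => ?_
    have d1 : HasFDerivAt (fun y : ℂ × ℂ => y.1) (ContinuousLinearMap.fst ℂ ℂ ℂ) y :=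
      hasFDerivAt_fst
    have d2 : HasFDerivAt (fun y : ℂ × ℂ => y.2) (ContinuousLinearMap.snd ℂ ℂ ℂ) y :=
      hasFDerivAt_snd
    have e1 : HasFDerivAt (fun y : ℂ × ℂ => exp (y.1 * τ)) _ y := (d1.mul_const (τ : ℂ)).cexp
    have e2 : HasFDerivAt (fun y : ℂ × ℂ => q τ ^ k * exp (y.2 * q τ)) _ y :=
      (d2.mul_const (q τ)).cexp.const_mul _
    refine ((e1.mul e2).const_mul (exp (-exp (τ : ℂ)))).congr_fderiv ?_
    ext <;> simp [hD, gammaKernel] <;> ring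

/-! ### Analytic continuation by partial integration -/

/-- Partial integration against the derivative of `e^{aτ}`. -/
theorem mul_integral_gammaKernel {q : ℝ → ℂ} (hq : Continuous q) {M : ℝ}
    (hM : ∀ τ, ‖q τ‖ ≤ M) {A : ℂ} (hA : ∀ τ : ℝ, HasDerivAt q (-A * exp τ * q τ ^ 2) τ)
    (k : ℕ) {a : ℂ} (ha : 0 < a.re) (w : ℂ) :
    a * ∫ τ, gammaKernel q k a w τ =
      (∫ τ, gammaKernel q k (a + 1) w τ) + k * A * (∫ τ, gammaKernel q (k + 1) (a + 1) w τ) +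
        A * w * ∫ τ, gammaKernel q (k + 2) (a + 1) w τ := by
  have ha' : 0 < (a + 1).re := by rw [add_re, one_re]; linarith
  have i0 := (integrable_gammaKernel hq hM k ha w).const_mul a
  have i1 := integrable_gammaKernel hq hM k ha' w
  have i2 := (integrable_gammaKernel hq hM (k + 1) ha' w).const_mul (k * A)
  have i3 := (integrable_gammaKernel hq hM (k + 2) ha' w).const_mul (A * w)
  have hd (τ : ℝ) : HasDerivAt (gammaKernel q k a w)
      (a * gammaKernel q k a w τ - (gammaKernel q k (a + 1) w τ +
        k * A * gammaKernel q (k + 1) (a + 1) w τ +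
        A * w * gammaKernel q (k + 2) (a + 1) w τ)) τ := by
    have t0 : HasDerivAt (fun τ : ℝ => (τ : ℂ)) 1 τ := ofRealCLM.hasDerivAt
    have h : HasDerivAt (gammaKernel q k a w) _ τ := t0.cexp.neg.cexp.mul
      ((t0.const_mul a).cexp.mul (((hA τ).pow k).mul ((hA τ).const_mul w).cexp))
    refine h.congr_deriv ?_
    -- the truncated exponent `k - 1` is harmless, as its coefficient vanishes at `k = 0`
    have hk : (k : ℂ) * q τ ^ (k - 1) * q τ ^ 2 = k * q τ ^ (k + 1) := by
      cases k with
      | zero => simp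
      | succ k => rw [Nat.add_sub_cancel]; ring
    have hexp : exp ((a + 1) * τ) = exp (a * τ) * exp τ := by rw [← exp_add]; ring_nf
    simp only [gammaKernel, hexp, Pi.pow_apply]
    linear_combination (-exp (-exp (τ : ℂ)) * exp (a * τ) * A * exp τ * exp (w * q τ)) * hk
  have h := integral_eq_zero_of_hasDerivAt_of_integrable hd (i0.sub ((i1.add i2).add i3))
    (integrable_gammaKernel hq hM k ha w)
  have hs : ∫ τ, (a * gammaKernel q k a w τ - (gammaKernel q k (a + 1) w τ +
        k * A * gammaKernel q (k + 1) (a + 1) w τ +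
        A * w * gammaKernel q (k + 2) (a + 1) w τ)) = _ := integral_sub i0 ((i1.add i2).add i3)
  have hs' : ∫ τ, (gammaKernel q k (a + 1) w τ + k * A * gammaKernel q (k + 1) (a + 1) w τ +
      A * w * gammaKernel q (k + 2) (a + 1) w τ) = _ := integral_add (i1.add i2) i3
  have hs'' : ∫ τ, (gammaKernel q k (a + 1) w τ +
      k * A * gammaKernel q (k + 1) (a + 1) w τ) = _ := integral_add i1 i2
  rw [hs, hs', hs'', integral_const_mul, integral_const_mul, integral_const_mul] at h
  exact sub_eq_zero.1 h

/-- The continuation of `Γ(a)⁻¹ ∫ s^{a-1} e^{-s} q^k e^{wq} ds` to the half plane `Re a > -n`, by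
`n` partial integrations; `A` is the constant in `dq/ds = -A q²`. For other `a` the integrals
diverge and the value has no meaning. -/
noncomputable def gammaContinuation (q : ℝ → ℂ) (A : ℂ) : ℕ → ℕ → ℂ → ℂ → ℂ
  | 0, k, a, w => (Gamma a)⁻¹ * ∫ τ, gammaKernel q k a w τ
  | n + 1, k, a, w => gammaContinuation q A n k (a + 1) w +
      k * A * gammaContinuation q A n (k + 1) (a + 1) w +
      A * w * gammaContinuation q A n (k + 2) (a + 1) w

/-- One more partial integration changes nothing where the continuation is already defined. -/
theorem gammaContinuation_succ {q : ℝ → ℂ} (hq : Continuous q) {M : ℝ}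
    (hM : ∀ τ, ‖q τ‖ ≤ M) {A : ℂ} (hA : ∀ τ : ℝ, HasDerivAt q (-A * exp τ * q τ ^ 2) τ)
    (n k : ℕ) {a : ℂ} (ha : -(n : ℝ) < a.re) (w : ℂ) :
    gammaContinuation q A (n + 1) k a w = gammaContinuation q A n k a w := by
  induction n generalizing k a with
  | zero =>
    have ha' : 0 < a.re := by simpa using ha
    have h0 : a ≠ 0 := by rintro rfl; simp at ha'
    have h := mul_integral_gammaKernel hq hM hA k ha' w
    simp only [gammaContinuation]
    rw [Gamma_add_one a h0, mul_inv]
    generalize (∫ τ, gammaKernel q k a w τ) = X at *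
    field_simp
    linear_combination -(Gamma a)⁻¹ * h
  | succ n ih =>
    have ha' : -(n : ℝ) < (a + 1).re := by
      rw [add_re, one_re]; push_cast at ha; linarith
    rw [gammaContinuation, ih _ ha', ih _ ha', ih _ ha', gammaContinuation]

theorem gammaContinuation_eq {q : ℝ → ℂ} (hq : Continuous q) {M : ℝ}
    (hM : ∀ τ, ‖q τ‖ ≤ M) {A : ℂ} (hA : ∀ τ : ℝ, HasDerivAt q (-A * exp τ * q τ ^ 2) τ)
    (n m k : ℕ) {a : ℂ} (hn : -(n : ℝ) < a.re) (hm : -(m : ℝ) < a.re) (w : ℂ) :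
    gammaContinuation q A n k a w = gammaContinuation q A m k a w := by
  have key (n l : ℕ) (hn : -(n : ℝ) < a.re) :
      gammaContinuation q A (n + l) k a w = gammaContinuation q A n k a w := by
    induction l with
    | zero => rfl
    | succ l ih =>
      rw [← add_assoc, gammaContinuation_succ hq hM hA _ _ _ w, ih]
      push_cast
      linarith [(Nat.cast_nonneg l : (0 : ℝ) ≤ l)]
  rw [← key n m hn, ← key m n hm, add_comm]

theorem differentiableAt_gammaContinuation {q : ℝ → ℂ} (hq : Continuous q) {M : ℝ}
    (hM : ∀ τ, ‖q τ‖ ≤ M) (A : ℂ) (n k : ℕ) {p : ℂ × ℂ} (hp : -(n : ℝ) < p.1.re) :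
    DifferentiableAt ℂ (fun p : ℂ × ℂ => gammaContinuation q A n k p.1 p.2) p := by
  induction n generalizing k p with
  | zero =>
    have hp' : 0 < p.1.re := by simpa using hp
    exact (differentiable_one_div_Gamma.differentiableAt.comp p differentiableAt_fst).mul
      (differentiableAt_integral_gammaKernel hq hM k hp')
  | succ n ih =>
    have hp' : -(n : ℝ) < (p.1 + 1).re := by
      rw [add_re, one_re]; push_cast at hp; linarith
    have hs : DifferentiableAt ℂ (fun p : ℂ × ℂ => (p.1 + 1, p.2)) p := by fun_prop
    have h (j : ℕ) : DifferentiableAt ℂ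
        (fun p : ℂ × ℂ => gammaContinuation q A n j (p.1 + 1) p.2) p :=
      DifferentiableAt.comp p (f := fun p : ℂ × ℂ => (p.1 + 1, p.2))
        (ih j (p := (p.1 + 1, p.2)) hp') hs
    simp only [gammaContinuation]
    exact ((h k).add ((h (k + 1)).const_mul _)).add
      ((differentiableAt_snd.const_mul A).mul (h (k + 2)))

/-- The Mellin transform of `e^{-s} q^k e^{wq}`, with the poles removed by `Γ`, is entire in the
Mellin variable and `w` together. -/
theorem exists_differentiable_integral_gammaKernel {q : ℝ → ℂ} (hq : Continuous q) {M : ℝ}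
    (hM : ∀ τ, ‖q τ‖ ≤ M) {A : ℂ} (hA : ∀ τ : ℝ, HasDerivAt q (-A * exp τ * q τ ^ 2) τ)
    (k : ℕ) :
    ∃ J : ℂ × ℂ → ℂ, Differentiable ℂ J ∧ ∀ a w : ℂ, 0 < a.re →
      ∫ τ, gammaKernel q k a w τ = Gamma a * J (a, w) := by
  have hN (a : ℂ) : -((⌊|a.re|⌋₊ + 1 : ℕ) : ℝ) < a.re := by
    have h1 := Nat.lt_floor_add_one |a.re|
    have h2 := neg_abs_le a.re
    push_cast
    linarith
  refine ⟨fun p => gammaContinuation q A (⌊|p.1.re|⌋₊ + 1) k p.1 p.2, fun p => ?_,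
    fun a w ha => ?_⟩
  · refine (differentiableAt_gammaContinuation hq hM A _ k (hN p.1)).congr_of_eventuallyEq ?_
    have ho : IsOpen {y : ℂ × ℂ | -((⌊|p.1.re|⌋₊ + 1 : ℕ) : ℝ) < y.1.re} :=
      isOpen_lt continuous_const (continuous_re.comp continuous_fst)
    filter_upwards [ho.mem_nhds (hN p.1)] with y hy
    exact gammaContinuation_eq hq hM hA _ _ k (hN y.1) hy y.2
  · simp only
    rw [gammaContinuation_eq hq hM hA _ 0 k (hN a) (by simpa using ha) w, gammaContinuation,
      mul_inv_cancel_left₀ (Gamma_ne_zero_of_re_pos ha)]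

/-! ### Truncated integrals -/

theorem norm_integral_sub_intervalIntegral_le {f : ℝ → ℂ} {g : ℝ → ℝ} (hf : Integrable f)
    (hg : Integrable g) (hfg : ∀ τ, ‖f τ‖ ≤ g τ) {a b : ℝ} (hab : a ≤ b) :
    ‖(∫ τ, f τ) - ∫ τ in a..b, f τ‖ ≤ (∫ τ, g τ) - ∫ τ in a..b, g τ := by
  rw [intervalIntegral.integral_of_le hab, intervalIntegral.integral_of_le hab,
    ← integral_add_compl measurableSet_Ioc hf, ← integral_add_compl measurableSet_Ioc hg,
    add_sub_cancel_left, add_sub_cancel_left]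
  exact norm_integral_le_of_norm_le hg.integrableOn (Eventually.of_forall hfg)

/-- The form in which both integrals of the star gamma function occur: up to a factor depending
on the point of `ℂ²` only, the integrand is a Mellin kernel. -/
theorem hasGammaIntegral_of_eq_gammaKernel {G : ℝ → (Fin 2 → ℂ) → ℂ} {q : ℝ → ℂ}
    (hq : Continuous q) {M : ℝ} (hM : ∀ τ, ‖q τ‖ ≤ M) (k : ℕ) {a : ℂ} (ha : 0 < a.re)
    {c w : (Fin 2 → ℂ) → ℂ} (hc : Continuous c) (hw : Continuous w)
    (hG : ∀ (τ : ℝ) x, exp (-exp (τ : ℂ)) * G τ x = c x * gammaKernel q k a (w x) τ) :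
    HasGammaIntegral G (fun x => c x * ∫ τ, gammaKernel q k a (w x) τ) := by
  have hi (x) : Integrable fun τ : ℝ => c x * gammaKernel q k a (w x) τ :=
    (integrable_gammaKernel hq hM k ha (w x)).const_mul _
  simp only [HasGammaIntegral, hG, ← integral_const_mul]
  refine ⟨hi, Metric.tendstoLocallyUniformly_iff.2 fun ε hε x => ?_⟩
  -- one integrable function dominates the integrands of all points near `x`
  set g : ℝ → ℝ := fun τ => (‖c x‖ + 1) * (M ^ k * Real.exp ((‖w x‖ + 1) * M) *
    (Real.exp (a.re * τ) * Real.exp (-Real.exp τ)))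
  have hg : Integrable g := ((integrable_exp_mul_exp_neg_exp ha).const_mul _).const_mul _
  have hcx : ∀ᶠ y in 𝓝 x, ‖c y‖ < ‖c x‖ + 1 :=
    hc.norm.continuousAt.eventually_lt continuousAt_const (by linarith)
  have hwx : ∀ᶠ y in 𝓝 x, ‖w y‖ < ‖w x‖ + 1 :=
    hw.norm.continuousAt.eventually_lt continuousAt_const (by linarith)
  refine ⟨_, hcx.and hwx, ?_⟩
  have h1 : Tendsto (fun T : ℝ × ℝ => -T.1) (atTop ×ˢ atTop) atBot :=
    tendsto_neg_atTop_atBot.comp tendsto_fst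
  have h2 : Tendsto (fun T : ℝ × ℝ => T.2) (atTop ×ˢ atTop) atTop := tendsto_snd
  have h3 := (intervalIntegral_tendsto_integral hg h1 h2).const_sub (∫ τ, g τ)
  rw [sub_self] at h3
  filter_upwards [h3.eventually (gt_mem_nhds hε), h1.eventually_le_atBot 0,
    h2.eventually_ge_atTop 0] with T hT hT1 hT2 y hy
  rw [dist_eq_norm]
  refine (norm_integral_sub_intervalIntegral_le (hi y) hg (fun τ => ?_)
    (hT1.trans hT2)).trans_lt hT
  rw [norm_mul]
  exact mul_le_mul hy.1.le (norm_gammaKernel_le hM k a hy.2.le τ) (norm_nonneg _) (by positivity)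

theorem HasGammaIntegral.unique {G : ℝ → (Fin 2 → ℂ) → ℂ} {f g : (Fin 2 → ℂ) → ℂ}
    (hf : HasGammaIntegral G f) (hg : HasGammaIntegral G g) : f = g :=
  funext fun x => tendsto_nhds_unique
    ((tendstoLocallyUniformlyOn_univ.2 hf.2).tendsto_at (Set.mem_univ x))
    ((tendstoLocallyUniformlyOn_univ.2 hg.2).tendsto_at (Set.mem_univ x))

/-- Two candidates agree for `Re z > -1/2`, hence everywhere by the identity theorem in `z`. -/
theorem IsStarSinMulGamma.unique {ħ κ : ℂ} {F G : ℂ → (Fin 2 → ℂ) → ℂ}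
    (hF : IsStarSinMulGamma ħ κ F) (hG : IsStarSinMulGamma ħ κ G) : G = F := by
  funext z x
  have hd {H : ℂ → (Fin 2 → ℂ) → ℂ} (hH : IsStarSinMulGamma ħ κ H) :
      AnalyticOnNhd ℂ (fun z => H z x) Set.univ :=
    analyticOnNhd_univ_iff_differentiable.2
      (hH.1.comp (differentiable_id.prodMk (differentiable_const x)))
  have he : (fun z => G z x) =ᶠ[𝓝 0] fun z => F z x := by
    have ho : IsOpen {z : ℂ | -(1 / 2) < z.re} := isOpen_lt continuous_const continuous_re
    filter_upwards [ho.mem_nhds (show -(1 / 2) < (0 : ℂ).re by norm_num)] with z hz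
    exact congrFun ((hG.2 z hz).unique (hF.2 z hz)) x
  exact congrFun ((hd hG).eq_of_eventuallyEq (hd hF) he) z

/-! ### The star exponential as a Mellin kernel -/

/-- `(A s + B)⁻¹` in the variable `s = e^τ`. -/
noncomputable def resolventExp (A B : ℂ) (τ : ℝ) : ℂ := (A * exp τ + B)⁻¹

theorem continuous_resolventExp {A B : ℂ} (h : ∀ τ : ℝ, A * exp τ + B ≠ 0) :
    Continuous (resolventExp A B) :=
  Continuous.inv₀ (by fun_prop) h

theorem hasDerivAt_resolventExp {A B : ℂ} (h : ∀ τ : ℝ, A * exp τ + B ≠ 0) (τ : ℝ) :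
    HasDerivAt (resolventExp A B) (-A * exp τ * resolventExp A B τ ^ 2) τ := by
  have t0 : HasDerivAt (fun τ : ℝ => (τ : ℂ)) 1 τ := ofRealCLM.hasDerivAt
  refine (((t0.cexp.const_mul A).add_const B).inv (h τ)).congr_deriv ?_
  rw [resolventExp, inv_pow, div_eq_mul_inv]
  ring

theorem norm_resolventExp_le {A B : ℂ} {m : ℝ} (hm : 0 < m)
    (h : ∀ τ : ℝ, m ≤ ‖A * exp τ + B‖) (τ : ℝ) : ‖resolventExp A B τ‖ ≤ m⁻¹ := by
  rw [resolventExp, norm_inv]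
  exact inv_anti₀ hm (h τ)

/-- On the real line the singular point `s = -(1 + κ) / (1 - κ)` of the star exponential stays at
a positive distance from the half line `s > 0`. -/
theorem exists_pos_le_norm_sub_add {κ : ℂ} (hre : κ.re < 0) (him : κ.im ≠ 0) :
    ∃ m : ℝ, 0 < m ∧ ∀ τ : ℝ, m ≤ ‖(1 - κ) * exp τ + (1 + κ)‖ := by
  have h1 : 0 < 1 - κ.re := by linarith
  have h2 : 0 < |κ.im| := abs_pos.2 him
  refine ⟨min 1 (|κ.im| / (1 - κ.re)), by positivity, fun τ => ?_⟩
  rw [← ofReal_exp]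
  set s := Real.exp τ
  have ere : ((1 - κ) * (s : ℂ) + (1 + κ)).re = 2 + (1 - κ.re) * (s - 1) := by simp; ring
  have eim : ((1 - κ) * (s : ℂ) + (1 + κ)).im = κ.im * (1 - s) := by simp; ring
  -- the imaginary part vanishes only at `s = 1`, near which the real part is close to `2`
  rcases le_total |s - 1| (1 / (1 - κ.re)) with h | h
  · refine (min_le_left _ _).trans (le_trans ?_ ((le_abs_self _).trans (abs_re_le_norm _)))
    rw [ere]
    have := (abs_le.1 h).1
    have h3 : (1 - κ.re) * (1 / (1 - κ.re)) = 1 := by field_simp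
    nlinarith
  · refine (min_le_right _ _).trans (le_trans ?_ (abs_im_le_norm _))
    rw [eim, abs_mul, abs_sub_comm, div_eq_mul_one_div]
    exact mul_le_mul_of_nonneg_left h h2.le

/-- On the lines `Im t = ± π` the singular point `s = (1 + κ) / (1 - κ)` of the star exponential
stays at a positive distance from the half line `s > 0`. -/
theorem abs_im_le_norm_sub_sub (κ : ℂ) (τ : ℝ) :
    |κ.im| ≤ ‖(1 - κ) * exp τ + -(1 + κ)‖ := by
  rw [← ofReal_exp]
  set s := Real.exp τ
  have hs : 0 < s := Real.exp_pos τ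
  have eim : ((1 - κ) * (s : ℂ) + -(1 + κ)).im = -(κ.im * (1 + s)) := by simp; ring
  refine le_trans ?_ (abs_im_le_norm _)
  rw [eim, abs_neg, abs_mul, abs_of_pos (by linarith : 0 < 1 + s)]
  nlinarith [abs_nonneg κ.im]

theorem exp_half_sq (t : ℂ) : exp t = exp (t / 2) ^ 2 := by
  rw [sq, exp_half_mul_self]

/-- With `s = e^τ` one has `Δ(τ) = s^{-1/2} ((1 - κ) s + (1 + κ))`: the factor `s^{1/2}` shifts the
Mellin variable to `z + 1/2`, and the Möbius function of `s` in the exponent is a constant plus a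
multiple of the resolvent. -/
theorem exp_neg_exp_mul_starExp {ħ κ : ℂ} (hκ : 1 - κ ≠ 0) (z : ℂ) (τ : ℝ)
    (h : (1 - κ) * exp τ + (1 + κ) ≠ 0) (x : Fin 2 → ℂ) :
    exp (-exp (τ : ℂ)) * starExp ħ κ z τ x =
      2 * exp (2 / (I * ħ) * (x 0 * x 1) / (1 - κ)) *
        gammaKernel (resolventExp (1 - κ) (1 + κ)) 1 (z + 1 / 2)
          (-2 / (1 - κ) * (2 / (I * ħ) * (x 0 * x 1))) τ := by
  rw [starExp, gammaKernel]
  generalize 2 / (I * ħ) * (x 0 * x 1) = W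
  have hP : exp ((τ : ℂ) / 2) ≠ 0 := exp_ne_zero _
  have hsq := exp_half_sq (τ : ℂ)
  have hD : starExpDenom κ τ =
      (exp ((τ : ℂ) / 2))⁻¹ * ((1 - κ) * exp τ + (1 + κ)) := by
    rw [starExpDenom, exp_neg, hsq]; field_simp
  have hZ : exp ((z + 1 / 2) * τ) = exp (τ * z) * exp ((τ : ℂ) / 2) := by
    rw [← exp_add]; ring_nf
  have hE : exp ((exp ((τ : ℂ) / 2) - exp (-((τ : ℂ) / 2))) / starExpDenom κ τ * W) =
      exp (W / (1 - κ)) * exp (-2 / (1 - κ) * W * resolventExp (1 - κ) (1 + κ) τ) := by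
    rw [← exp_add, resolventExp, hD, exp_neg]
    congr 1
    obtain ⟨N, hN⟩ : ∃ N, N = (1 - κ) * exp (τ : ℂ) + (1 + κ) := ⟨_, rfl⟩
    rw [← hN] at h ⊢
    rw [hsq] at hN
    generalize exp ((τ : ℂ) / 2) = P at *
    field_simp
    rw [hN]
    ring
  rw [hE, hZ, hD, resolventExp]
  generalize (1 - κ) * exp (τ : ℂ) + (1 + κ) = N at *
  field_simp

/-- The two exponentials on the lines `Im t = ± π` are proportional, and combine to a multiple of
`sin π(z + 1/2) = cos πz`. -/
theorem exp_neg_exp_mul_starSinMulExp {ħ κ : ℂ} (hκ : 1 - κ ≠ 0) (z : ℂ) (τ : ℝ)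
    (h : (1 - κ) * exp τ + -(1 + κ) ≠ 0) (x : Fin 2 → ℂ) :
    exp (-exp (τ : ℂ)) * starSinMulExp ħ κ z τ x =
      -2 * sin (Real.pi * (z + 1 / 2)) * exp (2 / (I * ħ) * (x 0 * x 1) / (1 - κ)) *
        gammaKernel (resolventExp (1 - κ) (-(1 + κ))) 1 (z + 1 / 2)
          (2 / (1 - κ) * (2 / (I * ħ) * (x 0 * x 1))) τ := by
  rw [starSinMulExp, starExp_sub_two_pi]
  simp only [starExp, gammaKernel]
  generalize 2 / (I * ħ) * (x 0 * x 1) = W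
  have hP : exp ((τ : ℂ) / 2) ≠ 0 := exp_ne_zero _
  have hsq := exp_half_sq (τ : ℂ)
  -- the shift by `πi` multiplies `e^{± t/2}` by `± i`
  have hA : exp (((τ : ℂ) + Real.pi * I) / 2) = I * exp ((τ : ℂ) / 2) := by
    rw [add_div, exp_add, show (Real.pi : ℂ) * I / 2 = Real.pi / 2 * I by ring,
      exp_pi_div_two_mul_I, mul_comm]
  have hD : starExpDenom κ (τ + Real.pi * I) =
      I * (exp ((τ : ℂ) / 2))⁻¹ * ((1 - κ) * exp τ + -(1 + κ)) := by
    rw [starExpDenom, exp_neg, hA, hsq, mul_inv, inv_I]; field_simp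
  have hZ : exp ((z + 1 / 2) * τ) = exp (τ * z) * exp ((τ : ℂ) / 2) := by
    rw [← exp_add]; ring_nf
  have hZ' : exp ((τ + Real.pi * I) * z) = exp (τ * z) * exp (Real.pi * I * z) := by
    rw [← exp_add]; ring_nf
  have hE : exp ((exp (((τ : ℂ) + Real.pi * I) / 2) - exp (-(((τ : ℂ) + Real.pi * I) / 2))) /
        starExpDenom κ (τ + Real.pi * I) * W) =
      exp (W / (1 - κ)) * exp (2 / (1 - κ) * W * resolventExp (1 - κ) (-(1 + κ)) τ) := by
    rw [← exp_add, resolventExp, hD, exp_neg, hA, mul_inv, inv_I]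
    congr 1
    obtain ⟨N, hN⟩ : ∃ N, N = (1 - κ) * exp (τ : ℂ) + -(1 + κ) := ⟨_, rfl⟩
    rw [← hN] at h ⊢
    rw [hsq] at hN
    generalize exp ((τ : ℂ) / 2) = P at *
    field_simp
    rw [hN]
    ring
  have hS : (1 + exp (-(2 * Real.pi * I * z))) * exp (Real.pi * I * z) =
      2 * sin (Real.pi * (z + 1 / 2)) := by
    rw [show (Real.pi : ℂ) * (z + 1 / 2) = Real.pi * z + Real.pi / 2 by ring, sin_add_pi_div_two,
      two_cos, add_mul, ← exp_add]
    ring_nf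
  rw [hE, hZ, hZ', hD, resolventExp]
  generalize (1 - κ) * exp (τ : ℂ) + -(1 + κ) = N at *
  generalize exp (W / (1 - κ)) = E1 at *
  generalize exp (2 / (1 - κ) * W * N⁻¹) = E2 at *
  generalize exp (-exp (τ : ℂ)) = E3 at *
  generalize sin (Real.pi * (z + 1 / 2)) = S at *
  generalize exp (-(2 * Real.pi * I * z)) = E4 at *
  generalize exp (Real.pi * I * z) = E5 at *
  generalize exp (τ * z) = E6 at *
  generalize exp ((τ : ℂ) / 2) = P at *
  have hI : I * I = -1 := I_mul_I
  field_simp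
  rw [I_sq]
  linear_combination E3 * E6 * E1 * E2 * hS

/-- Euler's reflection formula without denominators that can vanish. -/
theorem sin_pi_mul_mul_Gamma {a : ℂ} (ha : 0 < a.re) :
    sin (Real.pi * a) * Gamma a = Real.pi * (Gamma (1 - a))⁻¹ := by
  by_cases hs : sin (Real.pi * a) = 0
  -- here `a` is a positive integer, so `Γ(1 - a)` has a pole and Mathlib's `Gamma` the value `0`
  · obtain ⟨m, hm⟩ := sin_eq_zero_iff.1 hs
    have ham : a = m := by
      have hpi : (Real.pi : ℂ) ≠ 0 := ofReal_ne_zero.2 Real.pi_ne_zero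
      exact mul_left_cancel₀ hpi (by rw [hm, mul_comm])
    have hm0 : 0 < m := by rw [ham] at ha; exact_mod_cast ha
    obtain ⟨n, rfl⟩ : ∃ n : ℕ, m = n + 1 := ⟨(m - 1).toNat, by omega⟩
    have hG : Gamma (1 - a) = 0 := by
      rw [← Gamma_neg_nat_eq_zero n, ham]; push_cast; ring_nf
    rw [hs, hG]
    simp
  · have h := Gamma_mul_Gamma_one_sub a
    have h1 : Gamma (1 - a) ≠ 0 := by
      intro h0
      rw [h0, mul_zero, eq_comm, div_eq_zero_iff] at h
      exact h.elim (ofReal_ne_zero.2 Real.pi_ne_zero) hs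
    rw [eq_div_iff hs] at h
    rw [eq_mul_inv_iff_mul_eq₀ h1]
    linear_combination h

/-! ### The star gamma function -/

theorem exists_isStarGamma {ħ κ : ℂ} (hre : κ.re < 0) (him : κ.im ≠ 0) {z : ℂ}
    (hz : -(1 / 2) < z.re) : ∃ g, IsStarGamma ħ κ z g := by
  obtain ⟨m, hm, hle⟩ := exists_pos_le_norm_sub_add hre him
  have hκ : 1 - κ ≠ 0 := fun h => him (by simpa using congrArg im h)
  have hne (τ : ℝ) : (1 - κ) * exp τ + (1 + κ) ≠ 0 := norm_pos_iff.1 (hm.trans_le (hle τ))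
  have ha : 0 < (z + 1 / 2).re := by
    rw [add_re]; norm_num; linarith
  exact ⟨_, hasGammaIntegral_of_eq_gammaKernel (continuous_resolventExp hne)
    (norm_resolventExp_le hm hle) 1 ha (by fun_prop) (by fun_prop)
    fun τ x => exp_neg_exp_mul_starExp hκ z τ (hne τ) x⟩

/-- The value is `-2π / Γ(1/2 - z)` times an entire function: `sin π(z + 1/2)` removes the poles of
the Mellin transform, and the zeros of `1 / Γ(1/2 - z)` are the points `z = n + 1/2`. -/
theorem exists_isStarSinMulGamma {ħ κ : ℂ} (him : κ.im ≠ 0) :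
    ∃ F, IsStarSinMulGamma ħ κ F ∧ ∀ n : ℕ, F ((n : ℂ) + 1 / 2) = fun _ => 0 := by
  have hm : 0 < |κ.im| := abs_pos.2 him
  have hle := abs_im_le_norm_sub_sub κ
  have hκ : 1 - κ ≠ 0 := fun h => him (by simpa using congrArg im h)
  have hne (τ : ℝ) : (1 - κ) * exp τ + -(1 + κ) ≠ 0 := norm_pos_iff.1 (hm.trans_le (hle τ))
  have hq := continuous_resolventExp hne
  have hM := norm_resolventExp_le hm hle
  obtain ⟨J, hJ, hJeq⟩ := exists_differentiable_integral_gammaKernel hq hM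
    (hasDerivAt_resolventExp hne) 1
  refine ⟨fun z x => -2 * (Real.pi * (Gamma (1 - (z + 1 / 2)))⁻¹) *
    exp (2 / (I * ħ) * (x 0 * x 1) / (1 - κ)) *
    J (z + 1 / 2, 2 / (1 - κ) * (2 / (I * ħ) * (x 0 * x 1))), ⟨?_, fun z hz => ?_⟩, fun n => ?_⟩
  · have h1 : Differentiable ℂ fun p : ℂ × (Fin 2 → ℂ) => (Gamma (1 - (p.1 + 1 / 2)))⁻¹ :=
      differentiable_one_div_Gamma.comp (by fun_prop)
    have h2 : Differentiable ℂ fun p : ℂ × (Fin 2 → ℂ) =>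
        J (p.1 + 1 / 2, 2 / (1 - κ) * (2 / (I * ħ) * (p.2 0 * p.2 1))) :=
      hJ.comp (by fun_prop)
    fun_prop
  · have ha : 0 < (z + 1 / 2).re := by
      rw [add_re]; norm_num; linarith
    have h := hasGammaIntegral_of_eq_gammaKernel hq hM 1 ha (by fun_prop) (by fun_prop)
      fun τ x => exp_neg_exp_mul_starSinMulExp (ħ := ħ) hκ z τ (hne τ) x
    convert h using 2 with x
    dsimp only
    rw [hJeq _ _ ha, ← sin_pi_mul_mul_Gamma ha]
    ring
  · funext x
    -- `Γ` has a pole at `-n`, where Mathlib's `Gamma` and its inverse, the entire `1 / Γ`, are `0`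
    have hG : Gamma (1 - ((n : ℂ) + 1 / 2 + 1 / 2)) = 0 := by
      rw [← Gamma_neg_nat_eq_zero n]; ring_nf
    simp only [hG, inv_zero, mul_zero, zero_mul]

end StarAlgebra

theorem mainTheorem1 (ħ κ : ℂ) (hħ : ħ ≠ 0) (hre : κ.re < 0) (him : κ.im ≠ 0) :
    (∀ z : ℂ, -(1 / 2) < z.re → ∃ g, StarAlgebra.IsStarGamma ħ κ z g) ∧
    ∃ F : ℂ → (Fin 2 → ℂ) → ℂ,
      StarAlgebra.IsStarSinMulGamma ħ κ F ∧
      (∀ G, StarAlgebra.IsStarSinMulGamma ħ κ G → G = F) ∧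
      ∀ n : ℕ, F ((n : ℂ) + 1 / 2) = fun _ => 0 := by
  refine ⟨fun z hz => StarAlgebra.exists_isStarGamma hre him hz, ?_⟩
  obtain ⟨F, hF, h0⟩ := StarAlgebra.exists_isStarSinMulGamma (ħ := ħ) him
  exact ⟨F, hF, fun G hG => hF.unique hG, h0⟩
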